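/- \textbf{Theorem (Compressed SSC on noiseless data).} Let $\mathcal U^{(1)},\dots,\mathcal U^{(k)}\subseteq\mathbb R^d$ be linear subspaces and let $x_1,\dots,x_N\in\mathbb R^d$ be unit vectors (the columns of $\mathbf X$), each assigned to one cluster $\ell\in\{1,\dots,k\}$ with $x_i\in\mathcal U^{(\ell)}$. Write $\mathbf X^{(\ell)}$ for the points of cluster $\ell$ and $\mathbf X^{(\ell)}_{-i}$ for these points without $x_i$. Let $\lambda>0$. \emph{Subspace incoherence.} For $x_i$ in cluster $\ell$ let the dual direction $\nu(x_i)$ be the unique maximizer of $\langle x_i,\nu\rangle-\frac{\lambda}{2}\|\nu\|_2^2$ over all $\nu\in\mathbb R^d$ with $|\langle x_j,\nu\rangle|\le 1$ for all columns $x_j$ of $\mathbf X^{(\ell)}_{-i}$. Put $v(x_i)=\mathcal P_{\mathcal U^{(\ell)}}\nu(x_i)/\|\mathcal P_{\mathcal U^{(\ell)}}\nu(x_i)\|_2$, where $\mathcal P_{\mathcal U^{(\ell)}}$ is the orthogonal projection onto $\mathcal U^{(\ell)}$, and $$\mu_\ell=\max\{|\langle v(x_i),x_j\rangle| : x_i \text{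 in cluster } \ell,\ x_j \text{ not in cluster } \ell\},$$ with $\mu_\ell=0$ if there is no such pair. \emph{Inradius.} Let $\rho_\ell=\min_{i}\, r(\mathcal Q(\mathbf X^{(\ell)}_{-i}))$, the minimum running over the points $x_i$ of cluster $\ell$, where $\mathcal Q(\mathbf A)$ is the convex hull of the columns of $\mathbf A$ and their negatives, and $r(\cdot)$ is the radius of the largest ball of $\mathcal U^{(\ell)}$ contained in it ($0$ if there is none); put $\rho_\ell=0$ if cluster $\ell$ has no points. Let $\rho=\min_\ell\rho_\ell$ and $\Delta=\min_\ell(\rho_\ell-\mu_\ell)$. There is an absolute constant $K>0$ (independent of $d,p,N,k$, the data, $\mathbf\Psi$, $\lambda$ and $\epsilon$) for which the following holds. Assume $\mu_\ell<\rho_\ell$ for all $\ell$, and $0<\lambda<\rho/2$. Let $\mathbf\Psi\in\mathbb R^{p\times d}$ and $\epsilon$ satisfy $$\big|\langle x,y\rangle-\langle\mathbf\Psi x,\mathbf\Psi y\rangle\big|\le\epsilon\,\frac{\|x\|_2^2+\|y\|_2^2}{2}\qquad\text{for all }\ell,\ell'\text{ and all }x,y\in\mathcal U^{(\ell)}\cup\mathcal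 U^{(\ell')},$$ $$(1-\epsilon)\|x_i\|_2^2\le\|\mathbf\Psi x_i\|_2^2\le(1+\epsilon)\|x_i\|_2^2\qquad\text{for all }i,$$ and suppose that $$\epsilon\le K\,\Delta^2\lambda^{3/2}.$$ Let $\tilde x_i'=\mathbf\Psi x_i/\|\mathbf\Psi x_i\|_2$. Then Lasso SSC on $\tilde x_1',\dots,\tilde x_N'$ has the subspace detection property: whenever, for each $i$, $c_i\in\mathbb R^N$ minimizes $\|\tilde x_i'-\sum_j c_{ij}\tilde x_j'\|_2^2+2\lambda\|c_i\|_1$ subject to $c_{ii}=0$, one has, for each $i$, $c_i\ne 0$, and $c_{ij}\neq0$ only if $x_i$ and $x_j$ are in the same cluster. -/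

import Mathlib

noncomputable section

namespace CompressedSSC

/-- The Euclidean space of real vectors with `d` coordinates. -/
abbrev Vec (d : ℕ) := EuclideanSpace ℝ (Fin d)

/-! ### Lasso sparse subspace clustering -/

/-- The Lasso objective for the data point `x i`:
`‖x_i - ∑_j c_j x_j‖² + 2 lam ‖c‖₁`. -/
def lassoObjective {d N : ℕ} (lam : ℝ) (x : Fin N → Vec d) (i : Fin N) (c : Fin N → ℝ) : ℝ :=
  ‖x i - ∑ j, c j • x j‖ ^ 2 + 2 * lam * ∑ j, |c j|

/-- `C` is an output of Lasso SSC on the data `x`: for each `i`, the vector `c_i = C i`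
minimizes the Lasso objective for `x i` among all `c` with `c i = 0`. -/
def IsLassoSSCSolution {d N : ℕ} (lam : ℝ) (x : Fin N → Vec d) (C : Fin N → Fin N → ℝ) : Prop :=
  ∀ i, C i i = 0 ∧
    ∀ c : Fin N → ℝ, c i = 0 → lassoObjective lam x i (C i) ≤ lassoObjective lam x i c

/-- Subspace detection property of a similarity matrix, where `z i` is the cluster of the `i`th
data point: every `c_i` is nonzero, and `c_ij ≠ 0` only for `i`, `j` in the same cluster. -/
def SubspaceDetectionProperty {N k : ℕ} (z : Fin N → Fin k) (C : Fin N → Fin N → ℝ) : Prop :=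
  ∀ i, C i ≠ 0 ∧ ∀ j, C i j ≠ 0 → z i = z j

/-- Lasso SSC with parameter `lam` on the data `x` has the subspace detection property: every
solution of the Lasso problems (they need not be unique) has it. -/
def LassoSSCDetects {d N k : ℕ} (lam : ℝ) (x : Fin N → Vec d) (z : Fin N → Fin k) : Prop :=
  ∀ C : Fin N → Fin N → ℝ, IsLassoSSCSolution lam x C → SubspaceDetectionProperty z C

/-! ### Dual directions and subspace incoherence -/

/-- Feasibility in the dual problem: `|⟨a, ν⟩| ≤ 1` for all columns `a ∈ A`. -/
def DualFeasible {d : ℕ} (A : Set (Vec d)) (ν : Vec d) : Prop :=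
  ∀ a ∈ A, |inner ℝ a ν| ≤ 1

/-- The dual objective `⟨x, ν⟩ - (lam / 2) ⟨ν, ν⟩`. -/
def dualObjective {d : ℕ} (lam : ℝ) (x ν : Vec d) : ℝ :=
  inner ℝ x ν - lam / 2 * ‖ν‖ ^ 2

/-- `ν` solves the dual problem: maximize `dualObjective lam x` over the feasible vectors. -/
def IsDualDirection {d : ℕ} (lam : ℝ) (x : Vec d) (A : Set (Vec d)) (ν : Vec d) : Prop :=
  DualFeasible A ν ∧ ∀ ν', DualFeasible A ν' → dualObjective lam x ν' ≤ dualObjective lam x ν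

theorem dualObjective_eq {d : ℕ} {lam : ℝ} (hlam : 0 < lam) (x ν : Vec d) :
    dualObjective lam x ν
      = ‖x‖ ^ 2 / (2 * lam) - lam / 2 * ‖lam⁻¹ • x - ν‖ ^ 2 := by
  have h := @norm_sub_sq_real (Vec d) _ _ (lam⁻¹ • x) ν
  rw [h, inner_smul_left, norm_smul, Real.norm_eq_abs, abs_of_pos (inv_pos.2 hlam)]
  simp only [dualObjective, conj_trivial]
  field_simp
  ring

theorem convex_dualFeasible {d : ℕ} (A : Set (Vec d)) : Convex ℝ {ν | DualFeasible A ν} := by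
  intro u hu v hv s t hs ht hst a ha
  have h1 := abs_le.1 (hu a ha)
  have h2 := abs_le.1 (hv a ha)
  rw [inner_add_right, inner_smul_right, inner_smul_right, abs_le]
  constructor <;> nlinarith

theorem isClosed_dualFeasible {d : ℕ} (A : Set (Vec d)) : IsClosed {ν | DualFeasible A ν} := by
  have : {ν : Vec d | DualFeasible A ν} = ⋂ a ∈ A, {ν | |inner ℝ a ν| ≤ 1} := by
    ext ν; simp [DualFeasible]
  rw [this]
  exact isClosed_biInter fun a _ =>
    isClosed_le (continuous_abs.comp (continuous_const.inner continuous_id)) continuous_const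

/-- For `lam > 0` the dual problem has exactly one solution. -/
theorem existsUnique_isDualDirection {d : ℕ} {lam : ℝ} (hlam : 0 < lam) (x : Vec d)
    (A : Set (Vec d)) : ∃! ν, IsDualDirection lam x A ν := by
  have hne : {ν : Vec d | DualFeasible A ν}.Nonempty := ⟨0, fun a _ => by simp⟩
  obtain ⟨ν, hν, hdist⟩ := (isClosed_dualFeasible A).exists_infDist_eq_dist hne (lam⁻¹ • x)
  refine ⟨ν, ⟨hν, fun ν' hν' => ?_⟩, fun w hw => ?_⟩
  · have h : ‖lam⁻¹ • x - ν‖ ≤ ‖lam⁻¹ • x - ν'‖ := by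
      rw [← dist_eq_norm, ← dist_eq_norm, ← hdist]
      exact Metric.infDist_le_dist_of_mem hν'
    rw [dualObjective_eq hlam, dualObjective_eq hlam]
    have h2 := pow_le_pow_left₀ (norm_nonneg _) h 2
    nlinarith
  · have hmid : DualFeasible A ((1 / 2 : ℝ) • w + (1 / 2 : ℝ) • ν) :=
      convex_dualFeasible A hw.1 hν (by norm_num) (by norm_num) (by norm_num)
    have hm := hw.2 _ hmid
    have hn : ‖lam⁻¹ • x - ν‖ ≤ ‖lam⁻¹ • x - w‖ := by
      rw [← dist_eq_norm, ← dist_eq_norm, ← hdist]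
      exact Metric.infDist_le_dist_of_mem hw.1
    rw [dualObjective_eq hlam, dualObjective_eq hlam] at hm
    have hp := parallelogram_law_with_norm ℝ (lam⁻¹ • x - w) (lam⁻¹ • x - ν)
    have e1 : lam⁻¹ • x - w + (lam⁻¹ • x - ν)
        = (2 : ℝ) • (lam⁻¹ • x - ((1 / 2 : ℝ) • w + (1 / 2 : ℝ) • ν)) := by module
    have e2 : lam⁻¹ • x - w - (lam⁻¹ • x - ν) = -(w - ν) := by module
    rw [e1, e2, norm_neg, norm_smul, Real.norm_two] at hp
    have hn2 := pow_le_pow_left₀ (norm_nonneg _) hn 2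
    have hm2 : ‖lam⁻¹ • x - w‖ ^ 2
        ≤ ‖lam⁻¹ • x - ((1 / 2 : ℝ) • w + (1 / 2 : ℝ) • ν)‖ ^ 2 := by
      by_contra hcon
      push Not at hcon
      nlinarith
    have h0 : ‖w - ν‖ = 0 := by
      have : ‖w - ν‖ * ‖w - ν‖ ≤ 0 := by nlinarith
      nlinarith [norm_nonneg (w - ν)]
    exact sub_eq_zero.1 (norm_eq_zero.1 h0)

/-- The dual direction: the solution of the dual problem (unique for `lam > 0`). -/
def dualDirection {d : ℕ} (lam : ℝ) (x : Vec d) (A : Set (Vec d)) : Vec d :=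
  Classical.epsilon (IsDualDirection lam x A)

theorem isDualDirection_dualDirection {d : ℕ} {lam : ℝ} (hlam : 0 < lam) (x : Vec d)
    (A : Set (Vec d)) : IsDualDirection lam x A (dualDirection lam x A) :=
  Classical.epsilon_spec (existsUnique_isDualDirection hlam x A).exists

/-- The columns of the cluster of `x i`, with the `i`th column left out. -/
def clusterWithout {d N k : ℕ} (x : Fin N → Vec d) (z : Fin N → Fin k) (i : Fin N) :
    Set (Vec d) :=
  {a | ∃ j, j ≠ i ∧ z j = z i ∧ a = x j}

/-- The normalized dual direction `v(x_i) = P_U ν(x_i) / ‖P_U ν(x_i)‖`, where `U` is the subspace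
of the cluster of `x_i` and `ν(x_i)` is the dual direction of `x_i` with respect to the other
points of that cluster. -/
def normalizedDualDirection {d N k : ℕ} (lam : ℝ) (U : Fin k → Submodule ℝ (Vec d))
    (x : Fin N → Vec d) (z : Fin N → Fin k) (i : Fin N) : Vec d :=
  let w := (U (z i)).starProjection (dualDirection lam (x i) (clusterWithout x z i))
  ‖w‖⁻¹ • w

/-- Subspace incoherence `μ_ℓ`: the maximum of `|⟨v(x_i), x_j⟩|` over the points `x_i` of cluster
`ℓ` and the points `x_j` of all other clusters (`0` if there is no such pair). -/
def subspaceIncoherence {d N k : ℕ} (lam : ℝ) (U : Fin k → Submodule ℝ (Vec d))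
    (x : Fin N → Vec d) (z : Fin N → Fin k) (ℓ : Fin k) : ℝ :=
  sSup {t | ∃ i j, z i = ℓ ∧ z j ≠ ℓ ∧
    t = |inner ℝ (normalizedDualDirection lam U x z i) (x j)|}

/-! ### Inradius -/

/-- The symmetric convex hull `conv(± a : a ∈ A)`. -/
def symmConvexHull {d : ℕ} (A : Set (Vec d)) : Set (Vec d) :=
  convexHull ℝ (A ∪ {a | -a ∈ A})

/-- The radius of the largest ball of the subspace `U` that is contained in `K`. -/
def inradiusIn {d : ℕ} (U : Submodule ℝ (Vec d)) (K : Set (Vec d)) : ℝ :=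
  sSup {R | 0 ≤ R ∧ ∃ c ∈ U, Metric.closedBall c R ∩ (U : Set (Vec d)) ⊆ K}

/-- The inradius `ρ_ℓ`: the minimum, over the points `x_i` of cluster `ℓ`, of the inradius in `U ℓ`
of the symmetric convex hull of the other points of the cluster. -/
def clusterInradius {d N k : ℕ} (U : Fin k → Submodule ℝ (Vec d))
    (x : Fin N → Vec d) (z : Fin N → Fin k) (ℓ : Fin k) : ℝ :=
  ⨅ i : {i : Fin N // z i = ℓ}, inradiusIn (U ℓ) (symmConvexHull (clusterWithout x z i))

/-! ### Compression -/

/-- The action of a `p × d` matrix as a map between Euclidean spaces. -/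
def project {d p : ℕ} (Ψ : Matrix (Fin p) (Fin d) ℝ) (u : Vec d) : Vec p :=
  Matrix.toEuclideanLin Ψ u

/-- `Ψ` preserves, up to `ε`, inner products on `U ℓ ∪ U ℓ'` for all `ℓ`, `ℓ'`, and the norms of
the data points. -/
def PreservesGeometry {d p N k : ℕ} (Ψ : Matrix (Fin p) (Fin d) ℝ)
    (U : Fin k → Submodule ℝ (Vec d)) (x : Fin N → Vec d) (ε : ℝ) : Prop :=
  (∀ ℓ ℓ' : Fin k, ∀ u ∈ (U ℓ : Set (Vec d)) ∪ (U ℓ' : Set (Vec d)),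
    ∀ v ∈ (U ℓ : Set (Vec d)) ∪ (U ℓ' : Set (Vec d)),
      |inner ℝ u v - inner ℝ (project Ψ u) (project Ψ v)|
        ≤ ε * ((‖u‖ ^ 2 + ‖v‖ ^ 2) / 2)) ∧
  ∀ i, (1 - ε) * ‖x i‖ ^ 2 ≤ ‖project Ψ (x i)‖ ^ 2 ∧
    ‖project Ψ (x i)‖ ^ 2 ≤ (1 + ε) * ‖x i‖ ^ 2

/-- The projected data, with each column rescaled to unit norm. -/
def compressedData {d p N : ℕ} (Ψ : Matrix (Fin p) (Fin d) ℝ) (x : Fin N → Vec d) :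
    Fin N → Vec p :=
  fun i => ‖project Ψ (x i)‖⁻¹ • project Ψ (x i)

end CompressedSSC

end

/-!
The residual of a Lasso solution, divided by `lam`, solves the dual problem over all other points.
So it suffices to show that the dual direction of a compressed point with respect to its own
cluster is strictly feasible for the points of the other clusters: it then solves the full dual
problem as well, hence equals the scaled residual, and complementary slackness kills the
coefficients of the other clusters.

Dual directions lie in the span of the data, so the compressed one is the image `Ψ w` of a vector
`w ∈ U ℓ`, and both `w` and the uncompressed dual direction `ν` are bounded in terms of the
inradius `ρ`. After shrinking by a factor `1 - δ` with `δ` of order `ε / ρ`, each of `w` and `ν`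
becomes feasible for the problem of the other. Adding the two variational inequalities, tested
against these vectors, yields `lam * (ρ * ‖w - ν‖) ^ 2 ≤ 36 * ε`, and the incoherence bound for
`ν` passes to `w`. If the Lasso coefficients of a point vanished, then `lam * w` would be a multiple
of that point, and the bound on `‖w‖` would be violated.
-/

namespace CompressedSSC

/-! ### Dual directions -/

section Dual

variable {d : ℕ} {lam : ℝ} {x ν u : Vec d} {A B : Set (Vec d)}

theorem isDualDirection_iff_inner_nonpos (hlam : 0 < lam) :
    IsDualDirection lam x A ν ↔
      DualFeasible A ν ∧ ∀ u, DualFeasible A u → inner ℝ (x - lam • ν) (u - ν) ≤ 0 := by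
  refine and_congr_right fun hν => ?_
  have objective_le_iff (u : Vec d) : dualObjective lam x u ≤ dualObjective lam x ν ↔
      ‖lam⁻¹ • x - ν‖ ≤ ‖lam⁻¹ • x - u‖ := by
    rw [dualObjective_eq hlam, dualObjective_eq hlam, sub_le_sub_iff_left,
      mul_le_mul_iff_right₀ (half_pos hlam),
      pow_le_pow_iff_left₀ (norm_nonneg _) (norm_nonneg _) two_ne_zero]
  have inner_nonpos_iff (u : Vec d) : inner ℝ (x - lam • ν) (u - ν) ≤ 0 ↔
      inner ℝ (lam⁻¹ • x - ν) (u - ν) ≤ 0 := by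
    rw [show x - lam • ν = lam • (lam⁻¹ • x - ν) by rw [smul_sub, smul_inv_smul₀ hlam.ne'],
      real_inner_smul_left, ← smul_eq_mul, smul_nonpos_iff_nonpos_of_pos_left hlam]
  simp only [objective_le_iff, inner_nonpos_iff]
  have : Nonempty {u | DualFeasible A u} := ⟨⟨ν, hν⟩⟩
  have hbdd : BddBelow (Set.range fun u : {u | DualFeasible A u} => ‖lam⁻¹ • x - u‖) :=
    ⟨0, Set.forall_mem_range.2 fun _ => norm_nonneg _⟩
  refine Iff.trans ?_ (norm_eq_iInf_iff_real_inner_le_zero (convex_dualFeasible A) hν)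
  exact ⟨fun h => le_antisymm (le_ciInf fun u => h u u.2) (ciInf_le hbdd ⟨ν, hν⟩),
    fun h u hu => h.trans_le (ciInf_le hbdd ⟨u, hu⟩)⟩

theorem IsDualDirection.eq (hlam : 0 < lam) (hν : IsDualDirection lam x A ν)
    (hu : IsDualDirection lam x A u) : ν = u :=
  (existsUnique_isDualDirection hlam x A).unique hν hu

theorem IsDualDirection.of_subset (hν : IsDualDirection lam x A ν) (hAB : A ⊆ B)
    (hB : DualFeasible B ν) : IsDualDirection lam x B ν :=
  ⟨hB, fun u hu => hν.2 u fun a ha => hu a (hAB ha)⟩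

theorem inner_starProjection_of_mem {E : Type*} [NormedAddCommGroup E] [InnerProductSpace ℝ E]
    {V : Submodule ℝ E} [V.HasOrthogonalProjection] {a : E} (ha : a ∈ V) (v : E) :
    inner ℝ a (V.starProjection v) = inner ℝ a v := by
  rw [← Submodule.inner_starProjection_left_eq_right,
    Submodule.starProjection_eq_self_iff.2 ha]

/-- Projecting onto the subspace keeps a vector feasible and its inner product with `x`, so it can
only improve the objective. -/
theorem IsDualDirection.mem_submodule (hlam : 0 < lam) (hν : IsDualDirection lam x A ν)
    {V : Submodule ℝ (Vec d)} (hx : x ∈ V) (hA : A ⊆ V) : ν ∈ V := by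
  have hfeas : DualFeasible A (V.starProjection ν) := fun a ha => by
    rw [inner_starProjection_of_mem (hA ha)]
    exact hν.1 a ha
  have hobj := hν.2 _ hfeas
  rw [dualObjective, dualObjective, inner_starProjection_of_mem hx, sub_le_sub_iff_left,
    mul_le_mul_iff_right₀ (half_pos hlam),
    pow_le_pow_iff_left₀ (norm_nonneg _) (norm_nonneg _) two_ne_zero] at hobj
  exact (V.mem_iff_norm_starProjection ν).2 ((V.norm_starProjection_apply_le ν).antisymm hobj)

theorem dualFeasible_one_sub_smul {δ : ℝ} (hδ0 : 0 ≤ δ) (hδ1 : δ ≤ 1)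
    (hu : ∀ a ∈ A, |inner ℝ a u| ≤ 1 + δ) : DualFeasible A ((1 - δ) • u) := fun a ha => by
  have hδ : 0 ≤ 1 - δ := sub_nonneg.2 hδ1
  calc |inner ℝ a ((1 - δ) • u)| = (1 - δ) * |inner ℝ a u| := by
        rw [real_inner_smul_right, abs_mul, abs_of_nonneg hδ]
    _ ≤ (1 - δ) * (1 + δ) := by gcongr; exact hu a ha
    _ ≤ 1 := by nlinarith

end Dual

/-! ### Optimality conditions for the Lasso -/

theorem nonneg_of_forall_mul_add_sq_mul_nonneg {a b : ℝ}
    (h : ∀ t ∈ Set.Ioc (0 : ℝ) 1, 0 ≤ t * b + t ^ 2 * a) : 0 ≤ b := by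
  have hlim : Filter.Tendsto (fun t : ℝ => b + t * a) (nhdsWithin 0 (Set.Ioi 0)) (nhds b) :=
    (Continuous.tendsto' (by fun_prop) 0 b (by simp)).mono_left nhdsWithin_le_nhds
  refine ge_of_tendsto hlim ?_
  filter_upwards [Ioc_mem_nhdsGT one_pos] with t ht
  refine nonneg_of_mul_nonneg_right ?_ ht.1
  linarith [h t ht]

section Lasso

variable {d N k : ℕ} {lam : ℝ} {y : Fin N → Vec d} {C : Fin N → Fin N → ℝ} {i j : Fin N}

/-- The residual `y_i - ∑_j c_j y_j` of the representation of `y i` with coefficients `c`. -/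
noncomputable def lassoResidual (y : Fin N → Vec d) (i : Fin N) (c : Fin N → ℝ) : Vec d :=
  y i - ∑ j, c j • y j

theorem lassoObjective_add_single (lam : ℝ) (y : Fin N → Vec d) (i j : Fin N)
    (c : Fin N → ℝ) (t : ℝ) :
    lassoObjective lam y i (c + Pi.single j t) = lassoObjective lam y i c
      + (t ^ 2 * ‖y j‖ ^ 2 - 2 * t * inner ℝ (y j) (lassoResidual y i c)
        + 2 * lam * (|c j + t| - |c j|)) := by
  have hresidual : y i - ∑ l, (c + Pi.single j t : Fin N → ℝ) l • y l
      = lassoResidual y i c - t • y j := by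
    simp [lassoResidual, add_smul, Finset.sum_add_distrib, Pi.single_apply, sub_sub]
  have hpenalty : ∑ l, |(c + Pi.single j t : Fin N → ℝ) l| = ∑ l, |c l| + (|c j + t| - |c j|) := by
    rw [← sub_eq_iff_eq_add', ← Finset.sum_sub_distrib,
      Finset.sum_eq_single_of_mem j (Finset.mem_univ j) fun l _ hl => by simp [hl]]
    simp
  rw [lassoObjective, lassoObjective, hresidual, hpenalty, ← lassoResidual, norm_sub_sq_real,
    real_inner_smul_right, real_inner_comm, norm_smul, mul_pow, Real.norm_eq_abs, sq_abs]
  ring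

/-- Moving the coefficient `C i j` towards `C i j + t` changes the penalty at most linearly, by
convexity, and the squared residual only to first order by `-2 * t * ⟨y j, r⟩`. -/
theorem IsLassoSSCSolution.mul_inner_residual_le (hC : IsLassoSSCSolution lam y C)
    (hlam : 0 ≤ lam) (hij : j ≠ i) (t : ℝ) :
    t * inner ℝ (y j) (lassoResidual y i (C i)) ≤ lam * (|C i j + t| - |C i j|) := by
  suffices 0 ≤ 2 * (lam * (|C i j + t| - |C i j|)
      - t * inner ℝ (y j) (lassoResidual y i (C i))) by linarith
  refine nonneg_of_forall_mul_add_sq_mul_nonneg (a := t ^ 2 * ‖y j‖ ^ 2) fun s hs => ?_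
  have hmin := (hC i).2 (C i + Pi.single j (s * t)) (by simp [(hC i).1, hij.symm])
  rw [lassoObjective_add_single, le_add_iff_nonneg_right] at hmin
  have hconvex : |C i j + s * t| ≤ (1 - s) * |C i j| + s * |C i j + t| := by
    calc |C i j + s * t| = |(1 - s) * C i j + s * (C i j + t)| := by congr 1; ring
      _ ≤ |(1 - s) * C i j| + |s * (C i j + t)| := abs_add_le _ _
      _ = _ := by rw [abs_mul, abs_mul, abs_of_nonneg (sub_nonneg.2 hs.2), abs_of_pos hs.1]
  linarith [mul_le_mul_of_nonneg_left hconvex hlam]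

theorem IsLassoSSCSolution.abs_inner_residual_le (hC : IsLassoSSCSolution lam y C)
    (hlam : 0 ≤ lam) (hij : j ≠ i) : |inner ℝ (y j) (lassoResidual y i (C i))| ≤ lam := by
  have hup := hC.mul_inner_residual_le hlam hij 1
  have hlow := hC.mul_inner_residual_le hlam hij (-1)
  have hup' := abs_add_le (C i j) 1
  have hlow' := abs_add_le (C i j) (-1)
  rw [abs_neg] at hlow'
  rw [abs_one] at hup' hlow'
  rw [abs_le]
  constructor <;> nlinarith

theorem IsLassoSSCSolution.mul_abs_le (hC : IsLassoSSCSolution lam y C) (hlam : 0 ≤ lam)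
    (i j : Fin N) : lam * |C i j| ≤ C i j * inner ℝ (y j) (lassoResidual y i (C i)) := by
  rcases eq_or_ne j i with rfl | hij
  · simp [(hC j).1]
  · have h := hC.mul_inner_residual_le hlam hij (-C i j)
    rw [add_neg_cancel, abs_zero] at h
    linarith

theorem IsLassoSSCSolution.isDualDirection_residual (hC : IsLassoSSCSolution lam y C)
    (hlam : 0 < lam) (i : Fin N) :
    IsDualDirection lam (y i) {a | ∃ j, j ≠ i ∧ a = y j} (lam⁻¹ • lassoResidual y i (C i)) := by
  rw [isDualDirection_iff_inner_nonpos hlam]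
  constructor
  · rintro _ ⟨j, hij, rfl⟩
    rw [real_inner_smul_right, abs_mul, abs_of_pos (inv_pos.2 hlam), inv_mul_le_one₀ hlam]
    exact hC.abs_inner_residual_le hlam.le hij
  intro u hu
  rw [smul_inv_smul₀ hlam.ne', lassoResidual, sub_sub_cancel, ← lassoResidual, sum_inner]
  refine Finset.sum_nonpos fun j _ => ?_
  rw [real_inner_smul_left, inner_sub_right, mul_sub, sub_nonpos, real_inner_smul_right]
  calc C i j * inner ℝ (y j) u ≤ |C i j| := by
        rcases eq_or_ne j i with rfl | hij
        · simp [(hC j).1]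
        · calc C i j * inner ℝ (y j) u ≤ |C i j| * |inner ℝ (y j) u| := by
                rw [← abs_mul]; exact le_abs_self _
            _ ≤ |C i j| := mul_le_of_le_one_right (abs_nonneg _) (hu _ ⟨j, hij, rfl⟩)
    _ ≤ C i j * (lam⁻¹ * inner ℝ (y j) (lassoResidual y i (C i))) := by
        rw [mul_left_comm, le_inv_mul_iff₀ hlam]
        exact hC.mul_abs_le hlam.le i j

theorem IsLassoSSCSolution.eq_zero_of_abs_inner_residual_lt (hC : IsLassoSSCSolution lam y C)
    (hlt : |inner ℝ (y j) (lassoResidual y i (C i))| < lam) : C i j = 0 := by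
  by_contra hne
  have hslack := hC.mul_abs_le ((abs_nonneg _).trans hlt.le) i j
  have hle := le_abs_self (C i j * inner ℝ (y j) (lassoResidual y i (C i)))
  rw [abs_mul] at hle
  nlinarith [abs_pos.2 hne]

theorem IsLassoSSCSolution.lassoResidual_eq_of_isDualDirection
    (hC : IsLassoSSCSolution lam y C) (hlam : 0 < lam) {z : Fin N → Fin k} {ν : Vec d}
    (hν : IsDualDirection lam (y i) (clusterWithout y z i) ν)
    (hle : ∀ j, z j ≠ z i → |inner ℝ (y j) ν| ≤ 1) :
    lassoResidual y i (C i) = lam • ν := by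
  have hfull : IsDualDirection lam (y i) {a | ∃ j, j ≠ i ∧ a = y j} ν := by
    refine hν.of_subset (fun a ⟨j, hji, _, ha⟩ => ⟨j, hji, ha⟩) ?_
    rintro _ ⟨j, hji, rfl⟩
    by_cases hz : z j = z i
    · exact hν.1 _ ⟨j, hji, hz, rfl⟩
    · exact hle j hz
  rw [hfull.eq hlam (hC.isDualDirection_residual hlam i), smul_inv_smul₀ hlam.ne']

theorem IsLassoSSCSolution.same_cluster_of_strictly_feasible
    (hC : IsLassoSSCSolution lam y C) (hlam : 0 < lam) {z : Fin N → Fin k} {ν : Vec d}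
    (hν : IsDualDirection lam (y i) (clusterWithout y z i) ν)
    (hstrict : ∀ j, z j ≠ z i → |inner ℝ (y j) ν| < 1) (hj : C i j ≠ 0) : z i = z j := by
  by_contra hz
  refine hj (hC.eq_zero_of_abs_inner_residual_lt ?_)
  rw [hC.lassoResidual_eq_of_isDualDirection hlam hν fun j hz => (hstrict j hz).le,
    real_inner_smul_right, abs_mul, abs_of_pos hlam]
  exact mul_lt_of_lt_one_right hlam (hstrict j (Ne.symm hz))

end Lasso

/-! ### Inradius and subspace incoherence -/

section Inradius

variable {d N k : ℕ}

theorem abs_inner_le_of_mem_symmConvexHull {A : Set (Vec d)} {w q : Vec d} {M : ℝ}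
    (hM : ∀ a ∈ A, |inner ℝ a w| ≤ M) (hq : q ∈ symmConvexHull A) : |inner ℝ q w| ≤ M := by
  have hconv : Convex ℝ {q : Vec d | |inner ℝ q w| ≤ M} := by
    intro u hu v hv s t hs ht hst
    simp only [Set.mem_ofPred_eq, abs_le] at hu hv ⊢
    rw [inner_add_left, real_inner_smul_left, real_inner_smul_left]
    constructor <;> nlinarith
  refine convexHull_min ?_ hconv hq
  rintro a (ha | ha)
  · exact hM a ha
  · simpa using hM (-a) ha

/-- The ball need not be centred at `0`: the two points `c ± R * w / ‖w‖` are compared. -/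
theorem inradiusIn_mul_norm_le {V : Submodule ℝ (Vec d)} {A : Set (Vec d)} {w : Vec d} {M : ℝ}
    (hw : w ∈ V) (hM0 : 0 ≤ M) (hM : ∀ a ∈ A, |inner ℝ a w| ≤ M) :
    inradiusIn V (symmConvexHull A) * ‖w‖ ≤ M := by
  rcases eq_or_ne w 0 with rfl | hw0
  · simpa using hM0
  have hwpos : 0 < ‖w‖ := norm_pos_iff.2 hw0
  rw [← le_div_iff₀ hwpos]
  refine Real.sSup_le ?_ (by positivity)
  rintro R ⟨hR0, c, hcV, hball⟩
  rw [le_div_iff₀ hwpos]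
  set e := (R * ‖w‖⁻¹) • w
  have heV : e ∈ V := V.smul_mem _ hw
  have henorm : ‖e‖ ≤ R := by
    rw [norm_smul, Real.norm_of_nonneg (by positivity), inv_mul_cancel_right₀ hwpos.ne']
  have hinner : inner ℝ e w = R * ‖w‖ := by
    rw [real_inner_smul_left, real_inner_self_eq_norm_sq]
    field_simp
  have hplus := abs_inner_le_of_mem_symmConvexHull hM
    (hball ⟨by simpa [dist_eq_norm] using henorm, V.add_mem hcV heV⟩)
  have hminus := abs_inner_le_of_mem_symmConvexHull hM
    (hball ⟨by simpa [dist_eq_norm] using henorm, V.sub_mem hcV heV⟩)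
  rw [inner_add_left, hinner, abs_le] at hplus
  rw [inner_sub_left, hinner, abs_le] at hminus
  linarith [hplus.2, hminus.1]

variable {U : Fin k → Submodule ℝ (Vec d)} {x : Fin N → Vec d} {z : Fin N → Fin k} {i j : Fin N}

theorem clusterInradius_le_inradiusIn (U : Fin k → Submodule ℝ (Vec d)) (x : Fin N → Vec d)
    (z : Fin N → Fin k) (i : Fin N) :
    clusterInradius U x z (z i) ≤ inradiusIn (U (z i)) (symmConvexHull (clusterWithout x z i)) :=
  ciInf_le (f := fun j : {j : Fin N // z j = z i} =>
    inradiusIn (U (z i)) (symmConvexHull (clusterWithout x z j)))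
    (Set.finite_range _).bddBelow ⟨i, rfl⟩

theorem clusterInradius_mul_norm_le {w : Vec d} {M : ℝ} (hw : w ∈ U (z i)) (hM0 : 0 ≤ M)
    (hM : ∀ a ∈ clusterWithout x z i, |inner ℝ a w| ≤ M) :
    clusterInradius U x z (z i) * ‖w‖ ≤ M :=
  (mul_le_mul_of_nonneg_right (clusterInradius_le_inradiusIn U x z i) (norm_nonneg w)).trans
    (inradiusIn_mul_norm_le hw hM0 hM)

theorem clusterInradius_le_one (hxU : ∀ i, x i ∈ U (z i)) (hx1 : ∀ i, ‖x i‖ = 1) (i : Fin N) :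
    clusterInradius U x z (z i) ≤ 1 := by
  have hcorr : ∀ a ∈ clusterWithout x z i, |inner ℝ a (x i)| ≤ 1 := by
    rintro _ ⟨j, -, -, rfl⟩
    simpa [hx1] using abs_real_inner_le_norm (x j) (x i)
  simpa [hx1] using clusterInradius_mul_norm_le (hxU i) zero_le_one hcorr

theorem clusterWithout_subset (hxU : ∀ i, x i ∈ U (z i)) (i : Fin N) :
    clusterWithout x z i ⊆ U (z i) := by
  rintro _ ⟨j, -, hz, rfl⟩
  exact hz ▸ hxU j

theorem subspaceIncoherence_nonneg (lam : ℝ) (U : Fin k → Submodule ℝ (Vec d))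
    (x : Fin N → Vec d) (z : Fin N → Fin k) (ℓ : Fin k) :
    0 ≤ subspaceIncoherence lam U x z ℓ := by
  refine Real.sSup_nonneg ?_
  rintro t ⟨i, j, -, -, rfl⟩
  exact abs_nonneg _

theorem abs_inner_normalizedDualDirection_le (lam : ℝ) (U : Fin k → Submodule ℝ (Vec d))
    (x : Fin N → Vec d) (hij : z j ≠ z i) :
    |inner ℝ (normalizedDualDirection lam U x z i) (x j)|
      ≤ subspaceIncoherence lam U x z (z i) := by
  refine le_csSup (Set.Finite.bddAbove ?_) ⟨i, j, rfl, hij, rfl⟩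
  refine (Set.finite_range fun q : Fin N × Fin N =>
    |inner ℝ (normalizedDualDirection lam U x z q.1) (x q.2)|).subset ?_
  rintro t ⟨i', j', -, -, rfl⟩
  exact ⟨(i', j'), rfl⟩

/-- Since `ν` lies in `U (z i)`, the projection in the definition of the incoherence is trivial. -/
theorem IsDualDirection.abs_inner_le_subspaceIncoherence_mul_norm {lam : ℝ} {ν : Vec d}
    (hlam : 0 < lam) (hν : IsDualDirection lam (x i) (clusterWithout x z i) ν)
    (hxU : ∀ i, x i ∈ U (z i)) (hij : z j ≠ z i) :
    |inner ℝ (x j) ν| ≤ subspaceIncoherence lam U x z (z i) * ‖ν‖ := by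
  have hνU : ν ∈ U (z i) := hν.mem_submodule hlam (hxU i) (clusterWithout_subset hxU i)
  have hnormalized : normalizedDualDirection lam U x z i = ‖ν‖⁻¹ • ν := by
    rw [normalizedDualDirection, (isDualDirection_dualDirection hlam _ _).eq hlam hν,
      Submodule.starProjection_eq_self_iff.2 hνU]
  rcases eq_or_ne ν 0 with rfl | hν0
  · simp
  have hpos : 0 < ‖ν‖ := norm_pos_iff.2 hν0
  have h := abs_inner_normalizedDualDirection_le lam U x hij
  rwa [hnormalized, real_inner_smul_left, abs_mul, abs_of_pos (inv_pos.2 hpos), real_inner_comm,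
    inv_mul_le_iff₀' hpos] at h

end Inradius

/-! ### Perturbation by the compression -/

section Perturbation

variable {E F : Type*} [NormedAddCommGroup E] [InnerProductSpace ℝ E]
    [NormedAddCommGroup F] [InnerProductSpace ℝ F]

/-- The hypothesis is applied to unit vectors: by homogeneity, the arithmetic mean of the squared
norms may be replaced by the product of the norms. -/
theorem abs_inner_sub_inner_map_le (T : E →ₗ[ℝ] F) {V W : Submodule ℝ E} {ε : ℝ}
    (h : ∀ u ∈ V, ∀ v ∈ W, |inner ℝ u v - inner ℝ (T u) (T v)| ≤ ε * ((‖u‖ ^ 2 + ‖v‖ ^ 2) / 2))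
    {u v : E} (hu : u ∈ V) (hv : v ∈ W) :
    |inner ℝ u v - inner ℝ (T u) (T v)| ≤ ε * (‖u‖ * ‖v‖) := by
  rcases eq_or_ne u 0 with rfl | hu0
  · simp
  rcases eq_or_ne v 0 with rfl | hv0
  · simp
  have hup : 0 < ‖u‖ := norm_pos_iff.2 hu0
  have hvp : 0 < ‖v‖ := norm_pos_iff.2 hv0
  have hunit := h _ (V.smul_mem ‖u‖⁻¹ hu) _ (W.smul_mem ‖v‖⁻¹ hv)
  simp only [map_smul, real_inner_smul_left, real_inner_smul_right, norm_smul, norm_inv,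
    norm_norm, inv_mul_cancel₀ hup.ne', inv_mul_cancel₀ hvp.ne'] at hunit
  rw [← mul_sub, ← mul_sub, abs_mul, abs_mul, abs_of_pos (inv_pos.2 hup),
    abs_of_pos (inv_pos.2 hvp), inv_mul_le_iff₀ hvp, inv_mul_le_iff₀ hup] at hunit
  linarith

theorem abs_sub_one_le_of_abs_sq_sub_one_le {q ε : ℝ} (hq : 0 ≤ q) (h : |q ^ 2 - 1| ≤ ε) :
    |q - 1| ≤ ε :=
  calc |q - 1| ≤ |q - 1| * |q + 1| :=
        le_mul_of_one_le_right (abs_nonneg _) (by rw [abs_of_nonneg] <;> linarith)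
    _ = |q ^ 2 - 1| := by rw [← abs_mul]; ring_nf
    _ ≤ ε := h

theorem abs_inv_mul_sub_le {q ε b a m : ℝ} (hε : ε ≤ 1 / 2) (hq : |q - 1| ≤ ε)
    (hab : |a - b| ≤ ε * m) (ha : |a| ≤ m) : |q⁻¹ * b - a| ≤ 4 * ε * m := by
  have hε0 : 0 ≤ ε := (abs_nonneg _).trans hq
  have hqhalf : 1 / 2 ≤ q := by linarith [(abs_le.1 hq).1]
  have hqpos : 0 < q := by linarith
  have hsplit : q⁻¹ * b - a = q⁻¹ * ((b - a) - (q - 1) * a) := by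
    field_simp
    ring
  rw [hsplit, abs_mul, abs_of_pos (inv_pos.2 hqpos), inv_mul_le_iff₀ hqpos]
  calc |b - a - (q - 1) * a| ≤ |b - a| + |(q - 1) * a| := abs_sub _ _
    _ ≤ ε * m + ε * m := by
      rw [abs_sub_comm b a, abs_mul]
      gcongr
    _ ≤ q * (4 * ε * m) := by nlinarith [mul_nonneg hε0 ((abs_nonneg a).trans ha)]

theorem mul_sq_norm_sub_le_of_variational {x ν w : E} {lam δ η : ℝ}
    (hν : inner ℝ (x - lam • ν) ((1 - δ) • w - ν) ≤ 0)
    (hw : inner ℝ (x - lam • w) ((1 - δ) • ν - w) ≤ η) :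
    lam * ‖w - ν‖ ^ 2 ≤ δ * (inner ℝ x w + inner ℝ x ν - 2 * lam * inner ℝ ν w) + η := by
  simp only [inner_sub_left, inner_sub_right, real_inner_smul_left, real_inner_smul_right,
    real_inner_self_eq_norm_sq] at hν hw
  rw [norm_sub_sq_real, real_inner_comm ν w]
  rw [real_inner_comm ν w] at hw
  linarith

theorem mul_inner_add_inner_sub_le {x ν w : E} {lam ρ : ℝ} (hx : ‖x‖ = 1) (hlam : 0 ≤ lam)
    (hρ : 0 ≤ ρ) (hν : ρ * ‖ν‖ ≤ 1) (hw : ρ * ‖w‖ ≤ 3 / 2) (hlamw : lam * ‖w‖ ≤ 3 / 4) :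
    ρ * (inner ℝ x w + inner ℝ x ν - 2 * lam * inner ℝ ν w) ≤ 4 := by
  have hxw : inner ℝ x w ≤ ‖w‖ := by simpa [hx] using real_inner_le_norm x w
  have hxν : inner ℝ x ν ≤ ‖ν‖ := by simpa [hx] using real_inner_le_norm x ν
  have hνw : -inner ℝ ν w ≤ ‖ν‖ * ‖w‖ := neg_le.1 (neg_le_of_abs_le (abs_real_inner_le_norm ν w))
  calc ρ * (inner ℝ x w + inner ℝ x ν - 2 * lam * inner ℝ ν w)
      = ρ * (inner ℝ x w + inner ℝ x ν + 2 * lam * -inner ℝ ν w) := by ring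
    _ ≤ ρ * (‖w‖ + ‖ν‖ + 2 * lam * (‖ν‖ * ‖w‖)) := by gcongr
    _ = ρ * ‖w‖ + ρ * ‖ν‖ + 2 * (ρ * ‖ν‖) * (lam * ‖w‖) := by ring
    _ ≤ 3 / 2 + 1 + 2 * 1 * (3 / 4) := by gcongr
    _ = 4 := by norm_num

theorem mul_norm_one_sub_smul_sub_le {ν w : E} {δ ρ : ℝ} (hρ : 0 ≤ ρ) (hδ0 : 0 ≤ δ) (hδ1 : δ ≤ 1)
    (hν : ρ * ‖ν‖ ≤ 1) (hw : ρ * ‖w‖ ≤ 3 / 2) : ρ * ‖(1 - δ) • ν - w‖ ≤ 5 / 2 := by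
  have hshrink : ‖(1 - δ) • ν‖ ≤ ‖ν‖ := by
    rw [norm_smul, Real.norm_of_nonneg (sub_nonneg.2 hδ1)]
    exact mul_le_of_le_one_left (norm_nonneg _) (sub_le_self 1 hδ0)
  calc ρ * ‖(1 - δ) • ν - w‖ ≤ ρ * (‖ν‖ + ‖w‖) := by
        gcongr
        exact (norm_sub_le _ _).trans (by gcongr)
    _ ≤ 5 / 2 := by linarith

theorem mul_sq_mul_norm_sub_le {x ν w : E} {lam ε ρ : ℝ} (hx : ‖x‖ = 1) (hlam : 0 < lam)
    (hlamρ : lam ≤ ρ / 2) (hρ1 : ρ ≤ 1) (hε0 : 0 ≤ ε) (hερ : 6 * ε ≤ ρ)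
    (hν : ρ * ‖ν‖ ≤ 1) (hw : ρ * ‖w‖ ≤ 3 / 2)
    (hνopt : inner ℝ (x - lam • ν) ((1 - 6 * ε / ρ) • w - ν) ≤ 0)
    (hwopt : inner ℝ (x - lam • w) ((1 - 6 * ε / ρ) • ν - w)
      ≤ ε * (4 + lam * ‖w‖) * ‖(1 - 6 * ε / ρ) • ν - w‖) :
    lam * (ρ * ‖w - ν‖) ^ 2 ≤ 36 * ε := by
  have hρ : 0 < ρ := by linarith
  set δ := 6 * ε / ρ
  have hρδ : ρ * δ = 6 * ε := mul_div_cancel₀ _ hρ.ne'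
  have hlamw : lam * ‖w‖ ≤ 3 / 4 := by nlinarith [norm_nonneg w]
  have hscale := mul_inner_add_inner_sub_le hx hlam.le hρ.le hν hw hlamw
  have hdist := mul_norm_one_sub_smul_sub_le hρ.le (by positivity : 0 ≤ δ)
    ((div_le_one hρ).2 hερ) hν hw
  have herror : ρ ^ 2 * (ε * (4 + lam * ‖w‖) * ‖(1 - δ) • ν - w‖) ≤ 12 * ε := by
    calc ρ ^ 2 * (ε * (4 + lam * ‖w‖) * ‖(1 - δ) • ν - w‖)
        = ρ * (ε * (4 + lam * ‖w‖) * (ρ * ‖(1 - δ) • ν - w‖)) := by ring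
      _ ≤ 1 * (ε * (4 + 3 / 4) * (5 / 2)) := by gcongr
      _ ≤ 12 * ε := by linarith
  calc lam * (ρ * ‖w - ν‖) ^ 2 = ρ ^ 2 * (lam * ‖w - ν‖ ^ 2) := by ring
    _ ≤ ρ ^ 2 * (δ * (inner ℝ x w + inner ℝ x ν - 2 * lam * inner ℝ ν w)
          + ε * (4 + lam * ‖w‖) * ‖(1 - δ) • ν - w‖) := by
        gcongr
        exact mul_sq_norm_sub_le_of_variational hνopt hwopt
    _ = ρ * δ * (ρ * (inner ℝ x w + inner ℝ x ν - 2 * lam * inner ℝ ν w))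
          + ρ ^ 2 * (ε * (4 + lam * ‖w‖) * ‖(1 - δ) • ν - w‖) := by ring
    _ ≤ 6 * ε * 4 + 12 * ε := by
        rw [hρδ]
        gcongr
    _ = 36 * ε := by ring

end Perturbation

/-! ### Detection after compression -/

section Detection

variable {d p N k : ℕ} {U : Fin k → Submodule ℝ (Vec d)} {x : Fin N → Vec d}
  {z : Fin N → Fin k} {Ψ : Matrix (Fin p) (Fin d) ℝ} {lam ε : ℝ} {i j : Fin N}

theorem PreservesGeometry.abs_norm_sub_one_le (hΨ : PreservesGeometry Ψ U x ε)
    (hx1 : ∀ i, ‖x i‖ = 1) (i : Fin N) : |‖project Ψ (x i)‖ - 1| ≤ ε := by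
  obtain ⟨hlow, hup⟩ := hΨ.2 i
  rw [hx1, one_pow, mul_one] at hlow hup
  refine abs_sub_one_le_of_abs_sq_sub_one_le (norm_nonneg _) ?_
  rw [abs_sub_le_iff]
  constructor <;> linarith

theorem PreservesGeometry.abs_inner_sub_le (hΨ : PreservesGeometry Ψ U x ε) {ℓ ℓ' : Fin k}
    {u v : Vec d} (hu : u ∈ U ℓ) (hv : v ∈ U ℓ') :
    |inner ℝ u v - inner ℝ (project Ψ u) (project Ψ v)| ≤ ε * (‖u‖ * ‖v‖) :=
  abs_inner_sub_inner_map_le (Matrix.toEuclideanLin Ψ)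
    (fun u hu v hv => hΨ.1 ℓ ℓ' u (Or.inl hu) v (Or.inr hv)) hu hv

theorem PreservesGeometry.abs_inner_compressedData_sub_le (hΨ : PreservesGeometry Ψ U x ε)
    (hxU : ∀ i, x i ∈ U (z i)) (hx1 : ∀ i, ‖x i‖ = 1) (hε : ε ≤ 1 / 2) (j : Fin N)
    {ℓ : Fin k} {u : Vec d} (hu : u ∈ U ℓ) :
    |inner ℝ (compressedData Ψ x j) (project Ψ u) - inner ℝ (x j) u| ≤ 4 * ε * ‖u‖ := by
  rw [compressedData, real_inner_smul_left]
  refine abs_inv_mul_sub_le hε (hΨ.abs_norm_sub_one_le hx1 j) ?_ ?_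
  · simpa [hx1] using hΨ.abs_inner_sub_le (hxU j) hu
  · simpa [hx1] using abs_real_inner_le_norm (x j) u

theorem PreservesGeometry.inner_sub_smul_le (hΨ : PreservesGeometry Ψ U x ε)
    (hxU : ∀ i, x i ∈ U (z i)) (hx1 : ∀ i, ‖x i‖ = 1) (hε : ε ≤ 1 / 2) (hlam : 0 ≤ lam)
    (i : Fin N) {ℓ ℓ' : Fin k} {w u : Vec d} (hw : w ∈ U ℓ) (hu : u ∈ U ℓ') :
    inner ℝ (x i - lam • w) u
      ≤ inner ℝ (compressedData Ψ x i - lam • project Ψ w) (project Ψ u)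
        + ε * (4 + lam * ‖w‖) * ‖u‖ := by
  have hxu := (abs_le.1 (hΨ.abs_inner_compressedData_sub_le hxU hx1 hε i hu)).1
  have hwu := mul_le_mul_of_nonneg_left (abs_le.1 (hΨ.abs_inner_sub_le hw hu)).1 hlam
  simp only [inner_sub_left, real_inner_smul_left]
  linarith

theorem IsDualDirection.exists_project_eq (hlam : 0 < lam) (hxU : ∀ i, x i ∈ U (z i))
    {ν : Vec p}
    (hν : IsDualDirection lam (compressedData Ψ x i) (clusterWithout (compressedData Ψ x) z i) ν) :
    ∃ w ∈ U (z i), project Ψ w = ν := by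
  have hyU : ∀ j, compressedData Ψ x j ∈ (U (z j)).map (Matrix.toEuclideanLin Ψ) := fun j =>
    Submodule.smul_mem _ _ (Submodule.mem_map_of_mem (hxU j))
  exact hν.mem_submodule hlam (hyU i)
    (clusterWithout_subset (U := fun ℓ => (U ℓ).map (Matrix.toEuclideanLin Ψ)) hyU i)

theorem PreservesGeometry.abs_inner_le_of_dualFeasible_compressedData
    (hΨ : PreservesGeometry Ψ U x ε) (hxU : ∀ i, x i ∈ U (z i)) (hx1 : ∀ i, ‖x i‖ = 1)
    (hε : ε ≤ 1 / 2) {ℓ : Fin k} {w : Vec d} (hw : w ∈ U ℓ)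
    (hfeas : DualFeasible (clusterWithout (compressedData Ψ x) z i) (project Ψ w)) :
    ∀ a ∈ clusterWithout x z i, |inner ℝ a w| ≤ 1 + 4 * ε * ‖w‖ := by
  rintro _ ⟨j, hji, hz, rfl⟩
  have hdiff := hΨ.abs_inner_compressedData_sub_le hxU hx1 hε j hw
  rw [abs_sub_comm] at hdiff
  linarith [hfeas _ ⟨j, hji, hz, rfl⟩,
    abs_sub_abs_le_abs_sub (inner ℝ (x j) w) (inner ℝ (compressedData Ψ x j) (project Ψ w))]

theorem PreservesGeometry.abs_inner_compressedData_le_of_dualFeasible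
    (hΨ : PreservesGeometry Ψ U x ε) (hxU : ∀ i, x i ∈ U (z i)) (hx1 : ∀ i, ‖x i‖ = 1)
    (hε : ε ≤ 1 / 2) {ℓ : Fin k} {ν : Vec d} (hν : ν ∈ U ℓ)
    (hfeas : DualFeasible (clusterWithout x z i) ν) :
    ∀ a ∈ clusterWithout (compressedData Ψ x) z i,
      |inner ℝ a (project Ψ ν)| ≤ 1 + 4 * ε * ‖ν‖ := by
  rintro _ ⟨j, hji, hz, rfl⟩
  linarith [hfeas _ ⟨j, hji, hz, rfl⟩, hΨ.abs_inner_compressedData_sub_le hxU hx1 hε j hν,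
    abs_sub_abs_le_abs_sub (inner ℝ (compressedData Ψ x j) (project Ψ ν)) (inner ℝ (x j) ν)]

theorem PreservesGeometry.clusterInradius_mul_norm_le (hΨ : PreservesGeometry Ψ U x ε)
    (hxU : ∀ i, x i ∈ U (z i)) (hx1 : ∀ i, ‖x i‖ = 1)
    (hερ : 12 * ε ≤ clusterInradius U x z (z i)) {w : Vec d} (hw : w ∈ U (z i))
    (hfeas : DualFeasible (clusterWithout (compressedData Ψ x) z i) (project Ψ w)) :
    clusterInradius U x z (z i) * ‖w‖ ≤ 3 / 2 := by
  have hε0 : 0 ≤ ε := (abs_nonneg _).trans (hΨ.abs_norm_sub_one_le hx1 i)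
  have hε : ε ≤ 1 / 2 := by linarith [clusterInradius_le_one (z := z) hxU hx1 i]
  have hbound := CompressedSSC.clusterInradius_mul_norm_le hw (by positivity)
    (hΨ.abs_inner_le_of_dualFeasible_compressedData hxU hx1 hε hw hfeas)
  linarith [mul_le_mul_of_nonneg_right hερ (norm_nonneg w)]

theorem PreservesGeometry.inner_one_sub_smul_sub_nonpos (hΨ : PreservesGeometry Ψ U x ε)
    (hxU : ∀ i, x i ∈ U (z i)) (hx1 : ∀ i, ‖x i‖ = 1) (hε : ε ≤ 1 / 2) (hlam : 0 < lam)
    {ℓ : Fin k} {ν w : Vec d} {δ : ℝ} (hν : IsDualDirection lam (x i) (clusterWithout x z i) ν)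
    (hw : w ∈ U ℓ) (hfeas : DualFeasible (clusterWithout (compressedData Ψ x) z i) (project Ψ w))
    (hδ : 4 * ε * ‖w‖ ≤ δ) (hδ1 : δ ≤ 1) :
    inner ℝ (x i - lam • ν) ((1 - δ) • w - ν) ≤ 0 := by
  have hε0 : 0 ≤ ε := (abs_nonneg _).trans (hΨ.abs_norm_sub_one_le hx1 i)
  refine ((isDualDirection_iff_inner_nonpos hlam).1 hν).2 _
    (dualFeasible_one_sub_smul (hδ.trans' (by positivity)) hδ1 fun a ha => ?_)
  linarith [hΨ.abs_inner_le_of_dualFeasible_compressedData hxU hx1 hε hw hfeas a ha]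

theorem PreservesGeometry.inner_one_sub_smul_sub_le (hΨ : PreservesGeometry Ψ U x ε)
    (hxU : ∀ i, x i ∈ U (z i)) (hx1 : ∀ i, ‖x i‖ = 1) (hε : ε ≤ 1 / 2) (hlam : 0 < lam)
    {ℓ : Fin k} {ν w : Vec d} {δ : ℝ} (hν : ν ∈ U ℓ)
    (hfeas : DualFeasible (clusterWithout x z i) ν) (hw : w ∈ U ℓ)
    (hdual : IsDualDirection lam (compressedData Ψ x i) (clusterWithout (compressedData Ψ x) z i)
      (project Ψ w)) (hδ : 4 * ε * ‖ν‖ ≤ δ) (hδ1 : δ ≤ 1) :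
    inner ℝ (x i - lam • w) ((1 - δ) • ν - w)
      ≤ ε * (4 + lam * ‖w‖) * ‖(1 - δ) • ν - w‖ := by
  have hε0 : 0 ≤ ε := (abs_nonneg _).trans (hΨ.abs_norm_sub_one_le hx1 i)
  have hopt := ((isDualDirection_iff_inner_nonpos hlam).1 hdual).2 ((1 - δ) • project Ψ ν)
    (dualFeasible_one_sub_smul (hδ.trans' (by positivity)) hδ1 fun a ha => by
      linarith [hΨ.abs_inner_compressedData_le_of_dualFeasible hxU hx1 hε hν hfeas a ha])
  have hproject : project Ψ ((1 - δ) • ν - w) = (1 - δ) • project Ψ ν - project Ψ w := by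
    simp only [project, map_sub, map_smul]
  have hpert := hΨ.inner_sub_smul_le hxU hx1 hε hlam.le i hw
    ((U ℓ).sub_mem ((U ℓ).smul_mem (1 - δ) hν) hw)
  rw [hproject] at hpert
  linarith

theorem PreservesGeometry.mul_sq_mul_norm_sub_dualDirection_le
    (hΨ : PreservesGeometry Ψ U x ε) (hxU : ∀ i, x i ∈ U (z i)) (hx1 : ∀ i, ‖x i‖ = 1)
    (hlam : 0 < lam) (hlamρ : lam ≤ clusterInradius U x z (z i) / 2)
    (hερ : 12 * ε ≤ clusterInradius U x z (z i)) {ν w : Vec d}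
    (hν : IsDualDirection lam (x i) (clusterWithout x z i) ν) (hw : w ∈ U (z i))
    (hdual : IsDualDirection lam (compressedData Ψ x i) (clusterWithout (compressedData Ψ x) z i)
      (project Ψ w)) :
    lam * (clusterInradius U x z (z i) * ‖w - ν‖) ^ 2 ≤ 36 * ε := by
  have hνU : ν ∈ U (z i) := hν.mem_submodule hlam (hxU i) (clusterWithout_subset hxU i)
  have hρν := CompressedSSC.clusterInradius_mul_norm_le hνU zero_le_one hν.1
  have hρw := hΨ.clusterInradius_mul_norm_le hxU hx1 hερ hw hdual.1
  have hρ1 := clusterInradius_le_one (z := z) hxU hx1 i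
  set ρ := clusterInradius U x z (z i)
  have hρ : 0 < ρ := by linarith
  have hε0 : 0 ≤ ε := (abs_nonneg _).trans (hΨ.abs_norm_sub_one_le hx1 i)
  have hε : ε ≤ 1 / 2 := by linarith
  have hδ1 : 6 * ε / ρ ≤ 1 := (div_le_one hρ).2 (by linarith)
  have hδ {u : Vec d} (hu : ρ * ‖u‖ ≤ 3 / 2) : 4 * ε * ‖u‖ ≤ 6 * ε / ρ := by
    rw [le_div_iff₀ hρ]
    nlinarith
  exact mul_sq_mul_norm_sub_le (hx1 i) hlam hlamρ hρ1 hε0 (by linarith) hρν hρw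
    (hΨ.inner_one_sub_smul_sub_nonpos hxU hx1 hε hlam hν hw hdual.1 (hδ hρw) hδ1)
    (hΨ.inner_one_sub_smul_sub_le hxU hx1 hε hlam hνU hν.1 hw hdual (hδ (by linarith)) hδ1)

/-- Half of the slack `ρ - μ` absorbs the distance to the uncompressed dual direction, and the
other half the error of the compression. -/
theorem PreservesGeometry.abs_inner_compressedData_lt_one
    (hΨ : PreservesGeometry Ψ U x ε) (hxU : ∀ i, x i ∈ U (z i)) (hx1 : ∀ i, ‖x i‖ = 1)
    (hlam : 0 < lam) (hlamρ : lam ≤ clusterInradius U x z (z i) / 2)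
    (hερ : 12 * ε < clusterInradius U x z (z i) - subspaceIncoherence lam U x z (z i))
    (hε : 144 * ε
      ≤ (clusterInradius U x z (z i) - subspaceIncoherence lam U x z (z i)) ^ 2 * lam)
    {w : Vec d} (hw : w ∈ U (z i))
    (hdual : IsDualDirection lam (compressedData Ψ x i) (clusterWithout (compressedData Ψ x) z i)
      (project Ψ w)) (hij : z j ≠ z i) :
    |inner ℝ (compressedData Ψ x j) (project Ψ w)| < 1 := by
  set ν := dualDirection lam (x i) (clusterWithout x z i)
  have hν : IsDualDirection lam (x i) (clusterWithout x z i) ν :=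
    isDualDirection_dualDirection hlam _ _
  have hρν := CompressedSSC.clusterInradius_mul_norm_le
    (hν.mem_submodule hlam (hxU i) (clusterWithout_subset hxU i)) zero_le_one hν.1
  have hμ0 := subspaceIncoherence_nonneg lam U x z (z i)
  have hincoherent := hν.abs_inner_le_subspaceIncoherence_mul_norm hlam hxU hij
  have hρw := hΨ.clusterInradius_mul_norm_le hxU hx1 (by linarith) hw hdual.1
  have hdist := hΨ.mul_sq_mul_norm_sub_dualDirection_le hxU hx1 hlam hlamρ (by linarith) hν hw hdual
  have hρ1 := clusterInradius_le_one (z := z) hxU hx1 i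
  set ρ := clusterInradius U x z (z i)
  set μ := subspaceIncoherence lam U x z (z i)
  have hρ : 0 < ρ := by linarith
  have hε0 : 0 ≤ ε := (abs_nonneg _).trans (hΨ.abs_norm_sub_one_le hx1 i)
  have hclose : ρ * ‖w - ν‖ ≤ (ρ - μ) / 2 := by
    refine le_of_sq_le_sq (le_of_mul_le_mul_left ?_ hlam) (by linarith)
    linarith
  have hcompress := hΨ.abs_inner_compressedData_sub_le hxU hx1 (by linarith) j hw
  have hxj : |inner ℝ (x j) (w - ν)| ≤ ‖w - ν‖ := by
    simpa [hx1] using abs_real_inner_le_norm (x j) (w - ν)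
  have hsplit : inner ℝ (compressedData Ψ x j) (project Ψ w) = inner ℝ (x j) ν
      + inner ℝ (x j) (w - ν)
      + (inner ℝ (compressedData Ψ x j) (project Ψ w) - inner ℝ (x j) w) := by
    rw [inner_sub_right]
    ring
  refine lt_of_mul_lt_mul_left ?_ hρ.le
  calc ρ * |inner ℝ (compressedData Ψ x j) (project Ψ w)|
      ≤ ρ * (μ * ‖ν‖ + ‖w - ν‖ + 4 * ε * ‖w‖) := by
        gcongr
        rw [hsplit]
        exact (abs_add_three _ _ _).trans (by gcongr)
    _ = μ * (ρ * ‖ν‖) + ρ * ‖w - ν‖ + 4 * ε * (ρ * ‖w‖) := by ring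
    _ ≤ μ * 1 + (ρ - μ) / 2 + 4 * ε * (3 / 2) := by gcongr
    _ < ρ * 1 := by linarith

theorem PreservesGeometry.lassoSSCSolution_ne_zero
    (hΨ : PreservesGeometry Ψ U x ε) (hxU : ∀ i, x i ∈ U (z i)) (hx1 : ∀ i, ‖x i‖ = 1)
    (hlam : 0 < lam) (hlamρ : lam ≤ clusterInradius U x z (z i) / 2)
    (hερ : 12 * ε ≤ clusterInradius U x z (z i)) {C : Fin N → Fin N → ℝ}
    (hC : IsLassoSSCSolution lam (compressedData Ψ x) C) : C i ≠ 0 := by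
  intro hzero
  set q := ‖project Ψ (x i)‖
  have hq := abs_le.1 (hΨ.abs_norm_sub_one_le hx1 i)
  have hρ1 := clusterInradius_le_one (z := z) hxU hx1 i
  have hfeas : DualFeasible (clusterWithout (compressedData Ψ x) z i)
      (project Ψ ((lam⁻¹ * q⁻¹) • x i)) := by
    rintro _ ⟨j, hji, -, rfl⟩
    have hresidual := (hC.isDualDirection_residual hlam i).1 _ ⟨j, hji, rfl⟩
    simpa [q, lassoResidual, hzero, compressedData, project, mul_smul] using hresidual
  have hnorm := hΨ.clusterInradius_mul_norm_le hxU hx1 hερ ((U (z i)).smul_mem _ (hxU i)) hfeas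
  have hqpos : 0 < q := by linarith
  rw [norm_smul, hx1, mul_one, Real.norm_of_nonneg (by positivity), ← mul_inv, ← div_eq_mul_inv,
    div_le_iff₀ (by positivity)] at hnorm
  nlinarith

end Detection

theorem sq_ciInf_mul_rpow_le {ι : Type*} [Finite ι] {f : ι → ℝ} (hf : ∀ ℓ, 0 ≤ f ℓ) {lam s : ℝ}
    (hlam0 : 0 < lam) (hlam1 : lam ≤ 1) (hs : 1 ≤ s) (ℓ : ι) :
    (⨅ ℓ, f ℓ) ^ 2 * lam ^ s ≤ f ℓ ^ 2 * lam := by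
  gcongr
  · exact Real.iInf_nonneg hf
  · exact ciInf_le (Set.finite_range f).bddBelow ℓ
  · simpa using Real.rpow_le_rpow_of_exponent_ge hlam0 hlam1 hs

end CompressedSSC

theorem mainTheorem1_general {d p N k : ℕ} {U : Fin k → Submodule ℝ (CompressedSSC.Vec d)}
    {x : Fin N → CompressedSSC.Vec d} {z : Fin N → Fin k} {Ψ : Matrix (Fin p) (Fin d) ℝ}
    {lam ε : ℝ} (hxU : ∀ i, x i ∈ U (z i)) (hx1 : ∀ i, ‖x i‖ = 1)
    (hμρ : ∀ i, CompressedSSC.subspaceIncoherence lam U x z (z i)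
      < CompressedSSC.clusterInradius U x z (z i))
    (hlam : 0 < lam) (hlamρ : ∀ i, lam ≤ CompressedSSC.clusterInradius U x z (z i) / 2)
    (hΨ : CompressedSSC.PreservesGeometry Ψ U x ε)
    (hε : ∀ i, 144 * ε ≤ (CompressedSSC.clusterInradius U x z (z i)
      - CompressedSSC.subspaceIncoherence lam U x z (z i)) ^ 2 * lam) :
    CompressedSSC.LassoSSCDetects lam (CompressedSSC.compressedData Ψ x) z := by
  intro C hC i
  have hρ1 := CompressedSSC.clusterInradius_le_one (z := z) hxU hx1 i
  have hμ0 := CompressedSSC.subspaceIncoherence_nonneg lam U x z (z i)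
  have hερ : 12 * ε < CompressedSSC.clusterInradius U x z (z i)
      - CompressedSSC.subspaceIncoherence lam U x z (z i) := by
    nlinarith [hε i, hμρ i, hlamρ i]
  refine ⟨hΨ.lassoSSCSolution_ne_zero hxU hx1 hlam (hlamρ i) (by linarith) hC, fun j => ?_⟩
  have hν := CompressedSSC.isDualDirection_dualDirection hlam (CompressedSSC.compressedData Ψ x i)
    (CompressedSSC.clusterWithout (CompressedSSC.compressedData Ψ x) z i)
  obtain ⟨w, hw, hwν⟩ := hν.exists_project_eq hlam hxU
  rw [← hwν] at hν
  exact hC.same_cluster_of_strictly_feasible hlam hν fun j hij =>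
    hΨ.abs_inner_compressedData_lt_one hxU hx1 hlam (hlamρ i) hερ (hε i) hw hν hij

theorem mainTheorem1 :
    ∃ K : ℝ, 0 < K ∧
      ∀ (d p N k : ℕ) (U : Fin k → Submodule ℝ (CompressedSSC.Vec d))
        (x : Fin N → CompressedSSC.Vec d) (z : Fin N → Fin k)
        (Ψ : Matrix (Fin p) (Fin d) ℝ) (lam ε : ℝ),
        (∀ i, x i ∈ U (z i)) →
        (∀ i, ‖x i‖ = 1) →
        (∀ ℓ, CompressedSSC.subspaceIncoherence lam U x z ℓ
          < CompressedSSC.clusterInradius U x z ℓ) →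
        0 < lam →
        lam < (⨅ ℓ, CompressedSSC.clusterInradius U x z ℓ) / 2 →
        CompressedSSC.PreservesGeometry Ψ U x ε →
        ε ≤ K * (⨅ ℓ, (CompressedSSC.clusterInradius U x z ℓ
            - CompressedSSC.subspaceIncoherence lam U x z ℓ)) ^ 2 * lam ^ (3 / 2 : ℝ) →
        CompressedSSC.LassoSSCDetects lam (CompressedSSC.compressedData Ψ x) z := by
  refine ⟨1 / 144, by norm_num, ?_⟩
  intro d p N k U x z Ψ lam ε hxU hx1 hμρ hlam hlamρ hΨ hε
  have hlamρ' (i : Fin N) : lam ≤ CompressedSSC.clusterInradius U x z (z i) / 2 := by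
    linarith [ciInf_le (Set.finite_range (CompressedSSC.clusterInradius U x z)).bddBelow (z i)]
  refine mainTheorem1_general hxU hx1 (fun i => hμρ (z i)) hlam hlamρ' hΨ fun i => ?_
  have hlam1 : lam ≤ 1 := by
    linarith [hlamρ' i, CompressedSSC.clusterInradius_le_one (z := z) hxU hx1 i]
  linarith [CompressedSSC.sq_ciInf_mul_rpow_le (s := 3 / 2) (fun ℓ => sub_nonneg.2 (hμρ ℓ).le)
    hlam hlam1 (by norm_num) (z i)]
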